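/- An algebra (not necessarily associative or unital) over a field $k$ is called bicommutative if it satisfies the identities $x(yz)=y(xz)$ and $(xy)z=(xz)y$. Let $BC(X)$ denote the free bicommutative algebra over $k$ generated by a set $X$, and for $S\subseteq BC(X)$ let $BC(X\mid S)=BC(X)/\mathrm{Id}(S)$, where $\mathrm{Id}(S)$ is the two-sided ideal of $BC(X)$ generated by $S$. Let $k$ be an arbitrary field, let $X=\{x_1,\dots,x_n\}$ and $S\subseteq BC(X)$ be finite, and let $F$ be any computable field of coefficients contained in $k$ (that is, the elements of $F$ are coded by natural numbers in such a way that addition, negation, multiplication and inversion are computable; for example $F$ may be the prime field of $k$, or $F=k$ if $k$ itself is a computable field). Then the word problem of the finitely presented bicommutative algebra $BC(X\mid S)$ is solvable: there is an algorithm which, given two formal finite linear combinations $\sum_i a_i t_i$ and $\sum_j b_j u_j$ with coefficients $a_i,b_j\in F$ and with $t_i,u_j$ nonassociative words (bracketed words) in $x_1,\dots,x_n$, decides whether they represent the same element of $BC(X\mid S)$. -/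

import Mathlib

/-! ### Bicommutative algebras

A (not necessarily associative, not necessarily unital) algebra over `k` is given by
`[NonUnitalNonAssocRing A] [Module k A] [IsScalarTower k A A] [SMulCommClass k A A]`. -/

/-- The identities `x(yz) = y(xz)` and `(xy)z = (xz)y`. -/
class IsBicommutative (A : Type*) [Mul A] : Prop where
  left_comm : ∀ x y z : A, x * (y * z) = y * (x * z)
  right_comm : ∀ x y z : A, (x * y) * z = (x * z) * y

section Ideals

variable (k : Type*) [Field k] {A : Type*} [NonUnitalNonAssocRing A] [Module k A]

/-- A linear subspace is a (two-sided) ideal of the algebra `A` if it absorbs products with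
arbitrary elements of `A` on either side. -/
def IsAlgIdeal {k A : Type*} [Field k] [NonUnitalNonAssocRing A] [Module k A]
    (I : Submodule k A) : Prop :=
  ∀ a x : A, x ∈ I → a * x ∈ I ∧ x * a ∈ I

/-- `Id(S)`: the ideal of the algebra `A` generated by the set `S`. -/
def idealGen (S : Set A) : Submodule k A :=
  sInf {I : Submodule k A | S ⊆ I ∧ IsAlgIdeal I}

theorem subset_idealGen (S : Set A) : S ⊆ idealGen k S := by
  intro s hs
  simp only [idealGen, SetLike.mem_coe, Submodule.mem_sInf]
  exact fun I hI => hI.1 hs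

theorem isAlgIdeal_idealGen (S : Set A) : IsAlgIdeal (idealGen k S) := by
  intro a x hx
  simp only [idealGen, Submodule.mem_sInf] at hx ⊢
  exact ⟨fun I hI => (hI.2 a x (hx I hI)).1, fun I hI => (hI.2 a x (hx I hI)).2⟩

theorem idealGen_le {S : Set A} {I : Submodule k A} (hS : S ⊆ I) (hI : IsAlgIdeal I) :
    idealGen k S ≤ I :=
  sInf_le ⟨hS, hI⟩

/-- The quotient algebra `A / Id(S)`. -/
def QuotAlg (S : Set A) : Type _ := A ⧸ idealGen k S

namespace QuotAlg

variable (S : Set A)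

instance : AddCommGroup (QuotAlg k S) := inferInstanceAs (AddCommGroup (A ⧸ idealGen k S))

instance : Module k (QuotAlg k S) := inferInstanceAs (Module k (A ⧸ idealGen k S))

/-- The canonical projection `A → A / Id(S)`. -/
def mk : A →ₗ[k] QuotAlg k S := (idealGen k S).mkQ

theorem mk_surjective : Function.Surjective (mk k S) := (idealGen k S).mkQ_surjective

theorem mk_eq_mk_iff {a b : A} : mk k S a = mk k S b ↔ a - b ∈ idealGen k S :=
  Submodule.Quotient.eq (idealGen k S)

/-- The product of classes is the class of the product. -/
instance : Mul (QuotAlg k S) where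
  mul := Quotient.map₂ (· * ·) (by
    intro a a' ha b b' hb
    have ha' : a - a' ∈ idealGen k S := (Submodule.quotientRel_def _).1 ha
    have hb' : b - b' ∈ idealGen k S := (Submodule.quotientRel_def _).1 hb
    refine (Submodule.quotientRel_def _).2 ?_
    have h : a * b - a' * b' = (a - a') * b + a' * (b - b') := by
      rw [sub_mul, mul_sub]; abel
    rw [h]
    exact add_mem (isAlgIdeal_idealGen k S b _ ha').2 (isAlgIdeal_idealGen k S a' _ hb').1)

theorem mk_mul (a b : A) : mk k S (a * b) = mk k S a * mk k S b := rfl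

instance : NonUnitalNonAssocRing (QuotAlg k S) where
  left_distrib x y z := by
    obtain ⟨a, rfl⟩ := mk_surjective k S x
    obtain ⟨b, rfl⟩ := mk_surjective k S y
    obtain ⟨c, rfl⟩ := mk_surjective k S z
    simp only [← map_add, ← mk_mul, mul_add]
  right_distrib x y z := by
    obtain ⟨a, rfl⟩ := mk_surjective k S x
    obtain ⟨b, rfl⟩ := mk_surjective k S y
    obtain ⟨c, rfl⟩ := mk_surjective k S z
    simp only [← map_add, ← mk_mul, add_mul]
  zero_mul x := by
    obtain ⟨a, rfl⟩ := mk_surjective k S x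
    rw [← map_zero (mk k S), ← mk_mul, zero_mul]
  mul_zero x := by
    obtain ⟨a, rfl⟩ := mk_surjective k S x
    rw [← map_zero (mk k S), ← mk_mul, mul_zero]

instance [IsScalarTower k A A] : IsScalarTower k (QuotAlg k S) (QuotAlg k S) where
  smul_assoc c x y := by
    obtain ⟨a, rfl⟩ := mk_surjective k S x
    obtain ⟨b, rfl⟩ := mk_surjective k S y
    simp only [smul_eq_mul, ← map_smul, ← mk_mul, smul_mul_assoc]

instance [SMulCommClass k A A] : SMulCommClass k (QuotAlg k S) (QuotAlg k S) where
  smul_comm c x y := by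
    obtain ⟨a, rfl⟩ := mk_surjective k S x
    obtain ⟨b, rfl⟩ := mk_surjective k S y
    simp only [smul_eq_mul, ← map_smul, ← mk_mul, mul_smul_comm]

instance [IsBicommutative A] : IsBicommutative (QuotAlg k S) where
  left_comm x y z := by
    obtain ⟨a, rfl⟩ := mk_surjective k S x
    obtain ⟨b, rfl⟩ := mk_surjective k S y
    obtain ⟨c, rfl⟩ := mk_surjective k S z
    simp only [← mk_mul, IsBicommutative.left_comm a b c]
  right_comm x y z := by
    obtain ⟨a, rfl⟩ := mk_surjective k S x
    obtain ⟨b, rfl⟩ := mk_surjective k S y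
    obtain ⟨c, rfl⟩ := mk_surjective k S z
    simp only [← mk_mul, IsBicommutative.right_comm a b c]

end QuotAlg

end Ideals

/-- All the elements `a(bc) - b(ac)` and `(ab)c - (ac)b` of an algebra. -/
def bicommIdentities (A : Type*) [NonUnitalNonAssocRing A] : Set A :=
  {f | ∃ a b c : A, f = a * (b * c) - b * (a * c) ∨ f = (a * b) * c - (a * c) * b}

/-- `BC(X)`: the free bicommutative algebra over `k` generated by `X`, that is, the free
nonassociative algebra modulo the ideal generated by all values of the bicommutative identities. -/
abbrev FreeBicomm (k X : Type*) [Field k] : Type _ :=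
  QuotAlg k (bicommIdentities (FreeNonUnitalNonAssocAlgebra k X))

namespace FreeBicomm

variable (k : Type*) {X : Type*} [Field k]

/-- The generators of the free bicommutative algebra. -/
noncomputable def of (x : X) : FreeBicomm k X := QuotAlg.mk k _ (FreeNonUnitalNonAssocAlgebra.of k x)

instance : IsBicommutative (FreeBicomm k X) where
  left_comm x y z := by
    obtain ⟨a, rfl⟩ := QuotAlg.mk_surjective k _ x
    obtain ⟨b, rfl⟩ := QuotAlg.mk_surjective k _ y
    obtain ⟨c, rfl⟩ := QuotAlg.mk_surjective k _ z
    simp only [← QuotAlg.mk_mul]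
    exact (QuotAlg.mk_eq_mk_iff k _).2 (subset_idealGen k _ ⟨a, b, c, Or.inl rfl⟩)
  right_comm x y z := by
    obtain ⟨a, rfl⟩ := QuotAlg.mk_surjective k _ x
    obtain ⟨b, rfl⟩ := QuotAlg.mk_surjective k _ y
    obtain ⟨c, rfl⟩ := QuotAlg.mk_surjective k _ z
    simp only [← QuotAlg.mk_mul]
    exact (QuotAlg.mk_eq_mk_iff k _).2 (subset_idealGen k _ ⟨a, b, c, Or.inr rfl⟩)

end FreeBicomm

/-- `BC(X | S) = BC(X) / Id(S)`: the bicommutative algebra with generators `X` and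
defining relations `s = 0` for `s ∈ S`. -/
abbrev PresentedBicomm {k X : Type*} [Field k] (S : Set (FreeBicomm k X)) : Type _ :=
  QuotAlg k S

/-- The image in `BC(X | S)` of a generator. -/
noncomputable def PresentedBicomm.of {k X : Type*} [Field k] (S : Set (FreeBicomm k X)) (x : X) :
    PresentedBicomm S :=
  QuotAlg.mk k S (FreeBicomm.of k x)

/-! ### Coding of terms -/

/-- The code of a term (a bracketed word) in the letters `0, …, n`: the letter `i` has the
code `i`, and a product has the code `n + 1 + ⟨code of left factor, code of right factor⟩`. -/
def termCode {n : ℕ} : FreeMagma (Fin (n + 1)) → ℕ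
  | .of i => i
  | .mul s t => n + 1 + Nat.pair (termCode s) (termCode t)

/-- The term with a given code. -/
def termDecode (n : ℕ) (m : ℕ) : FreeMagma (Fin (n + 1)) :=
  if h : m < n + 1 then .of ⟨m, h⟩
  else .mul (termDecode n (m - (n + 1)).unpair.1) (termDecode n (m - (n + 1)).unpair.2)
termination_by m
decreasing_by
  · have := Nat.unpair_left_le (m - (n + 1)); omega
  · have := Nat.unpair_right_le (m - (n + 1)); omega

theorem termDecode_termCode {n : ℕ} (t : FreeMagma (Fin (n + 1))) :
    termDecode n (termCode t) = t := by
  induction t with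
  | ih1 i => rw [termCode, termDecode, dif_pos i.2]
  | ih2 s t hs ht =>
    change termDecode n (n + 1 + Nat.pair (termCode s) (termCode t)) = _
    rw [termDecode, dif_neg (by omega), Nat.add_sub_cancel_left, Nat.unpair_pair, hs, ht]
    rfl

theorem termCode_termDecode (n m : ℕ) : termCode (termDecode n m) = m := by
  induction m using Nat.strong_induction_on with
  | _ m ih =>
    rw [termDecode]
    split_ifs with h
    · rfl
    · have h1 := Nat.unpair_left_le (m - (n + 1))
      have h2 := Nat.unpair_right_le (m - (n + 1))
      rw [termCode, ih _ (by omega), ih _ (by omega), Nat.pair_unpair]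
      omega

/-- Terms in a nonempty finite alphabet correspond bijectively to their codes. -/
def termEquiv (n : ℕ) : FreeMagma (Fin (n + 1)) ≃ ℕ where
  toFun := termCode
  invFun := termDecode n
  left_inv := termDecode_termCode
  right_inv := termCode_termDecode n

theorem term_isEmpty : FreeMagma (Fin 0) → False
  | .of i => i.elim0
  | .mul s _ => term_isEmpty s

/-- There are no terms in the empty alphabet. -/
def termZeroEquiv : FreeMagma (Fin 0) ≃ Empty where
  toFun t := (term_isEmpty t).elim
  invFun e := e.elim
  left_inv t := (term_isEmpty t).elim
  right_inv e := e.elim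

instance termPrimcodable : (n : ℕ) → Primcodable (FreeMagma (Fin n))
  | 0 => Primcodable.ofEquiv Empty termZeroEquiv
  | n + 1 => Primcodable.ofEquiv ℕ (termEquiv n)

/-! ### The word problem -/

/-- A computable field: a field with a coding of its elements by natural numbers for which
the field operations are computable (equality is decidable because codes are unique). -/
structure IsComputableField (F : Type*) [Field F] [Primcodable F] : Prop where
  add : Computable₂ fun a b : F => a + b
  neg : Computable fun a : F => -a
  mul : Computable₂ fun a b : F => a * b
  inv : Computable fun a : F => a⁻¹

/-- A formal linear combination `a₁ t₁ + ⋯ + aᵣ tᵣ` of terms in the letters `x₁, …, xₙ`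
with coefficients in `F`, written as the list of the pairs `(aᵢ, tᵢ)`. -/
abbrev LinWord (F : Type*) (n : ℕ) : Type _ := List (F × FreeMagma (Fin n))

/-- The value of a formal linear combination of terms at the elements `x₁, …, xₙ` of a
`k`-algebra, where `F` is a subfield of `k`. -/
def LinWord.eval {F : Type*} [Field F] (k : Type*) [Field k] [Algebra F k] {n : ℕ} {B : Type*}
    [NonUnitalNonAssocRing B] [Module k B] (x : Fin n → B) (w : LinWord F n) : B :=
  (w.map fun p => algebraMap F k p.1 • FreeMagma.lift x p.2).sum

/-- The word problem of the bicommutative algebra `BC(x₁, …, xₙ | S)`, for words with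
coefficients in `F`, is solvable: there is an algorithm that decides, for any two formal linear
combinations of terms, whether they represent the same element of the algebra. -/
def WordProblemSolvable (F : Type*) [Field F] [Primcodable F] {k : Type*} [Field k] [Algebra F k]
    {n : ℕ} (S : Set (FreeBicomm k (Fin n))) : Prop :=
  ComputablePred fun p : LinWord F n × LinWord F n =>
    p.1.eval k (PresentedBicomm.of S) = p.2.eval k (PresentedBicomm.of S)

/-! ### Words with the same content have the same value -/

/-! On products, all left and right multiplications of a bicommutative algebra commute, and
multiplication by a product `st`, from either side, acts as left multiplication by `s` combined with
right multiplication by `t`. Hence a word of length at least two evaluates to a multiset of letters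
`L_i`, `R_i` acting on some `x_a x_b`. The two identities exchange `a` with any `L_c` and `b` with
any `R_c` of the multiset, so the value depends only on the multiset enlarged by `L_a` and `R_b`
(`lift_mul_congr`). Such words behave like commutative monomials in `2n` variables.

Distinct primes attached to the letters turn these monomials into natural numbers (signatures),
multiplication by a generator into multiplication by a prime, and the order of `ℕ` into a monomial
order. The `F`-linear relations between values of words become a space `J` of formal sums of
signatures, stable under the letters. By Dickson's lemma the leading signatures of products in `J`
are multiples of finitely many of them, so `J` has a finite Gröbner basis: its translates reduce
every vector to a normal form, and `J` contains no nonzero normal form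
(`computablePred_mem_of_letterOp_closed`).

The basis need not be computed from the presentation: it is a finite amount of data that can be
built into the algorithm. The algorithm enumerates combinations of translates until the residue is a
normal form, then tests whether it vanishes (`computablePred_mem_of_reduction`). Only arithmetic in
`F` is used; `k` and `S` enter through `J` alone. -/

namespace IsBicommutative

variable {A : Type*} [Mul A] [IsBicommutative A]

/-- Left and right multiplications commute on products. -/
theorem mul_mul_mul_right (x y p q : A) : x * (p * q * y) = x * (p * q) * y := by
  have h₁ : x * (p * q) * y = p * (x * q * y) := by
    rw [right_comm x (p * q) y, left_comm (x * y) p q, right_comm x y q]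
  have h₂ : x * (p * q * y) = p * (x * q * y) := by
    rw [left_comm x (p * q) y, right_comm p q (x * y), left_comm p x y, right_comm x (p * y) q,
      left_comm (x * q) p y]
  rw [h₁, h₂]

variable (A) in
/-- The elements of a magma that are products. -/
abbrev Products : Type _ := {u : A // ∃ a b, u = a * b}

variable {X : Type*} (x : X → A)

/-- The letter `inl i` acts on products as left multiplication by `x i`, the letter `inr i` as
right multiplication by `x i`. -/
def letterAct : X ⊕ X → Products A → Products A
  | .inl i, u => ⟨x i * u.1, _, _, rfl⟩
  | .inr i, u => ⟨u.1 * x i, _, _, rfl⟩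

instance : LeftCommutative (letterAct x) where
  left_comm := by
    rintro (i | i) (j | j) ⟨_, p, q, rfl⟩ <;> refine Subtype.ext ?_
    · exact left_comm _ _ _
    · exact mul_mul_mul_right _ _ _ _
    · exact (mul_mul_mul_right _ _ _ _).symm
    · exact right_comm _ _ _

/-- The action of a multiset of letters on products. -/
def multisetAct (m : Multiset (X ⊕ X)) (u : Products A) : Products A :=
  m.foldr (letterAct x) u

theorem multisetAct_add (m m' : Multiset (X ⊕ X)) (u : Products A) :
    multisetAct x (m + m') u = multisetAct x m (multisetAct x m' u) :=
  Multiset.foldr_add _ _ _ _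

theorem multisetAct_singleton (c : X ⊕ X) (u : Products A) :
    multisetAct x {c} u = letterAct x c u :=
  Multiset.foldr_singleton _ _ _

end IsBicommutative

/-- The multisets of letters by which left and right multiplication by a word act on products. -/
def FreeMagma.content {X : Type*} : FreeMagma X → Multiset (X ⊕ X) × Multiset (X ⊕ X)
  | .of i => ({.inl i}, {.inr i})
  | .mul s t => (s.content.1 + t.content.2, s.content.1 + t.content.2)

namespace IsBicommutative

variable {A : Type*} [Mul A] [IsBicommutative A] {X : Type*} (x : X → A)

theorem lift_mul_eq_multisetAct (t : FreeMagma X) (u : Products A) :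
    FreeMagma.lift x t * u.1 = (multisetAct x t.content.1 u).1 ∧
      u.1 * FreeMagma.lift x t = (multisetAct x t.content.2 u).1 := by
  induction t generalizing u with
  | ih1 i => simp [FreeMagma.content, multisetAct_singleton, letterAct]
  | ih2 s t hs ht =>
    change FreeMagma.lift x (s * t) * u.1 = (multisetAct x (s.content.1 + t.content.2) u).1 ∧
      u.1 * FreeMagma.lift x (s * t) = (multisetAct x (s.content.1 + t.content.2) u).1
    constructor
    · rw [map_mul, right_comm, (hs u).1, (ht _).2, ← multisetAct_add, add_comm]
    · rw [map_mul, left_comm, (ht u).2, (hs _).1, ← multisetAct_add]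

/-- The product of two generators. -/
def genMul (a b : X) : Products A := ⟨x a * x b, _, _, rfl⟩

theorem act_inl_genMul (m : Multiset (X ⊕ X)) (a b c : X) :
    multisetAct x (m + {.inl c}) (genMul x a b) = multisetAct x (m + {.inl a}) (genMul x c b) := by
  rw [multisetAct_add, multisetAct_add, multisetAct_singleton, multisetAct_singleton]
  congr 1
  exact Subtype.ext (left_comm _ _ _)

theorem act_inr_genMul (m : Multiset (X ⊕ X)) (a b c : X) :
    multisetAct x (m + {.inr c}) (genMul x a b) = multisetAct x (m + {.inr b}) (genMul x a c) := by
  rw [multisetAct_add, multisetAct_add, multisetAct_singleton, multisetAct_singleton]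
  congr 1
  exact Subtype.ext (right_comm _ _ _)

theorem exists_eq_add_singleton_of_ne {Y : Type*} {m m' : Multiset Y} {a a' : Y} (hne : a ≠ a')
    (h : m + {a} = m' + {a'}) : ∃ m₁, m = m₁ + {a'} ∧ m' = m₁ + {a} := by
  classical
  have h' : a' ∈ m + {a} := by rw [h]; simp
  have h1 : a' ∈ m := by simpa [hne.symm] using h'
  obtain ⟨m₁, rfl⟩ := Multiset.exists_cons_of_mem h1
  refine ⟨m₁, by rw [add_comm, Multiset.singleton_add], ?_⟩
  rw [← Multiset.singleton_add, add_assoc, add_comm {a'} (m₁ + {a})] at h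
  exact (add_right_cancel h).symm

/-- At most one exchange of left letters and one exchange of right letters are needed to make the
two starting products agree; the remaining multisets are then equal by cancellation. -/
theorem act_genMul_congr {m m' : Multiset (X ⊕ X)} {a b a' b' : X}
    (h : m + {.inl a} + {.inr b} = m' + {.inl a'} + {.inr b'}) :
    multisetAct x m (genMul x a b) = multisetAct x m' (genMul x a' b') := by
  have key : ∀ {m m' : Multiset (X ⊕ X)} {b b' : X}, m + {.inr b} = m' + {.inr b'} →
      multisetAct x m (genMul x a b) = multisetAct x m' (genMul x a b') := by
    intro m m' b b' h
    by_cases hb : b = b'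
    · subst hb; rw [add_right_cancel h]
    · obtain ⟨m₁, rfl, rfl⟩ := exists_eq_add_singleton_of_ne (by simpa using hb) h
      exact act_inr_genMul x _ _ _ _
  rw [add_right_comm m, add_right_comm m'] at h
  by_cases ha : a = a'
  · subst ha; exact key (add_right_cancel h)
  · obtain ⟨m₁, h₁, h₂⟩ := exists_eq_add_singleton_of_ne (by simpa using ha) h
    obtain ⟨m₂, rfl⟩ : ∃ m₂, m' = m₂ + {.inl a} := by
      have : Sum.inl a ∈ m' + {Sum.inr b'} := by rw [h₂]; simp
      obtain ⟨m₂, rfl⟩ := Multiset.exists_cons_of_mem (show Sum.inl a ∈ m' by simpa using this)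
      exact ⟨m₂, by rw [add_comm, Multiset.singleton_add]⟩
    -- As `a ≠ a'`, the letter `inl a` occurs in `m'`; exchanging it with `a'` makes both left
    -- factors equal to `a`.
    rw [← act_inl_genMul]
    refine key ?_
    rw [h₁, add_right_comm, ← add_right_cancel (h₂.symm.trans (add_right_comm _ _ _))]

theorem exists_lift_eq (t : FreeMagma X) : (∃ i, t = .of i) ∨ ∃ m a b,
    (t.content.1 = m + {.inl a} + {.inr b} ∧ t.content.2 = m + {.inl a} + {.inr b}) ∧
      FreeMagma.lift x t = (multisetAct x m (genMul x a b)).1 := by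
  induction t with
  | ih1 i => exact .inl ⟨i, rfl⟩
  | ih2 s t hs ht =>
    right
    suffices ∃ m a b, s.content.1 + t.content.2 = m + {.inl a} + {.inr b} ∧
        FreeMagma.lift x (s * t) = (multisetAct x m (genMul x a b)).1 by
      obtain ⟨m, a, b, h, h'⟩ := this
      exact ⟨m, a, b, ⟨h, h⟩, h'⟩
    rcases ht with ⟨j, rfl⟩ | ⟨m, a, b, ⟨-, hm⟩, h⟩
    · rcases hs with ⟨i, rfl⟩ | ⟨m, a, b, ⟨hm, -⟩, h⟩
      · exact ⟨0, i, j, by simp [FreeMagma.content], rfl⟩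
      · refine ⟨{.inr j} + m, a, b, ?_, ?_⟩
        · rw [hm, FreeMagma.content]; simp only [add_assoc, add_comm, add_left_comm]
        · rw [map_mul, h, (lift_mul_eq_multisetAct x _ _).2, multisetAct_add]; rfl
    · refine ⟨s.content.1 + m, a, b, by rw [hm]; simp only [add_assoc], ?_⟩
      rw [map_mul, h, (lift_mul_eq_multisetAct x s _).1, multisetAct_add]

/-- The reduction to commutative monomials: both words are brought to the form of `exists_lift_eq`,
and their total contents agree. -/
theorem lift_mul_congr {s t s' t' : FreeMagma X}
    (h : s.content.1 + t.content.2 = s'.content.1 + t'.content.2) :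
    FreeMagma.lift x (s * t) = FreeMagma.lift x (s' * t') := by
  rcases exists_lift_eq x (s * t) with ⟨i, hi⟩ | ⟨m, a, b, ⟨hm, -⟩, hst⟩
  · cases hi
  rcases exists_lift_eq x (s' * t') with ⟨i, hi⟩ | ⟨m', a', b', ⟨hm', -⟩, hst'⟩
  · cases hi
  rw [hst, hst', act_genMul_congr x (hm.symm.trans (Eq.trans h hm'))]

end IsBicommutative

/-! ### Deciding membership in a subspace by searching for a reduced representative -/

/-! ### Computability of list operations -/

namespace Computable

variable {α β σ : Type*} [Primcodable α] [Primcodable β] [Primcodable σ]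

theorem list_foldl {f : α → List β} {g : α → σ} {h : α → σ × β → σ} (hf : Computable f)
    (hg : Computable g) (hh : Computable₂ h) :
    Computable fun a => (f a).foldl (fun s b => h a (s, b)) (g a) := by
  -- The fold becomes a recursion on the position. Past the end of the list the state would be kept,
  -- but only `(f a).length` steps are made.
  have hstep : Computable₂ fun (a : α) (p : ℕ × σ) =>
      (Option.casesOn ((f a)[p.1]?) p.2 fun b => h a (p.2, b) : σ) := by
    refine option_casesOn (o := fun q : α × ℕ × σ => (f q.1)[q.2.1]?) (f := fun q => q.2.2)
      (g := fun q b => h q.1 (q.2.2, b)) ?_ (snd.comp snd) ?_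
    · exact list_getElem?.comp (hf.comp fst) (fst.comp snd)
    · exact hh.comp (fst.comp fst) (pair (snd.comp (snd.comp fst)) snd)
  refine (nat_rec (list_length.comp hf) hg hstep).of_eq fun a => ?_
  have key : ∀ k ≤ (f a).length, (Nat.rec (g a) (fun y IH =>
      (Option.casesOn ((f a)[y]?) IH fun b => h a (IH, b) : σ)) k : σ) =
        ((f a).take k).foldl (fun s b => h a (s, b)) (g a) := by
    intro k hk
    induction k with
    | zero => simp
    | succ k ih =>
      have hk' : k < (f a).length := hk
      simp only [ih hk'.le, List.getElem?_eq_getElem hk', List.take_add_one, Option.toList_some,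
        List.foldl_append, List.foldl_cons, List.foldl_nil]
  simpa using key _ le_rfl

theorem list_flatMap {f : α → List β} {g : α → β → List σ} (hf : Computable f)
    (hg : Computable₂ g) : Computable fun a => (f a).flatMap (g a) := by
  refine (list_foldl (h := fun a p => p.1 ++ g a p.2) hf (const []) ?_).of_eq fun a => ?_
  · exact list_append.comp (fst.comp snd) (hg.comp fst (snd.comp snd))
  · rw [← List.flatMap_eq_foldl]

theorem list_map {f : α → List β} {g : α → β → σ} (hf : Computable f) (hg : Computable₂ g) :
    Computable fun a => (f a).map (g a) := by
  refine (list_flatMap (g := fun a b => [] ++ [g a b]) hf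
    (list_concat.comp (const []) hg)).of_eq fun a => ?_
  exact List.flatMap_pure_eq_map _ _

theorem list_all {f : α → List β} {q : α → β → Bool} (hf : Computable f) (hq : Computable₂ q) :
    Computable fun a => (f a).all (q a) := by
  refine (list_foldl (h := fun a p => p.1 && q a p.2) hf (const true) ?_).of_eq fun a => ?_
  · exact Primrec.and.to_comp.comp (fst.comp snd) (hq.comp fst (snd.comp snd))
  · have : ∀ (l : List β) (b : Bool), l.foldl (fun s x => s && q a x) b = (b && l.all (q a)) := by
      intro l
      induction l with
      | nil => simp
      | cons x l ih => intro b; simp [ih, Bool.and_assoc]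
    simpa using this (f a) true

end Computable

/-! ### Vectors as formal sums, and reduction modulo a family -/

section FormalSums

variable {F ι κ : Type*} [Field F]

/-- The element of `ι →₀ F` written as a formal sum. -/
noncomputable def listSum (l : List (F × ι)) : ι →₀ F :=
  (l.map fun e => Finsupp.single e.2 e.1).sum

theorem listSum_append (l l' : List (F × ι)) : listSum (l ++ l') = listSum l + listSum l' := by
  simp [listSum]

theorem listSum_cons (e : F × ι) (l : List (F × ι)) :
    listSum (e :: l) = Finsupp.single e.2 e.1 + listSum l := by
  simp [listSum]

theorem exists_listSum_eq (f : ι →₀ F) :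
    ∃ l : List (F × ι), listSum l = f ∧ ∀ e ∈ l, e.2 ∈ f.support := by
  refine ⟨f.support.toList.map fun i => (f i, i), ?_, by simp⟩
  simp only [listSum, List.map_map]
  exact (Finset.sum_map_toList f.support _).trans f.sum_single

theorem listSum_map (g : ι → κ) (l : List (F × ι)) :
    listSum (l.map fun e => (e.1, g e.2)) = Finsupp.mapDomain g (listSum l) := by
  induction l with
  | nil => simp [listSum]
  | cons e l ih => simp [listSum_cons, ih, Finsupp.mapDomain_add, Finsupp.mapDomain_single]

/-- Multiplication of a formal sum by a scalar. -/
def scaleList (c : F) (l : List (F × ι)) : List (F × ι) := l.map fun e => (c * e.1, e.2)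

theorem listSum_scaleList (c : F) (l : List (F × ι)) :
    listSum (scaleList c l) = c • listSum l := by
  induction l with
  | nil => simp [listSum, scaleList]
  | cons e l ih =>
    rw [listSum_cons, smul_add, ← ih, Finsupp.smul_single, smul_eq_mul]
    exact listSum_cons _ _

/-- The sum of a formal sum and a linear combination of the vectors `v j`. -/
def residue (v : κ → List (F × ι)) (w : List (F × ι)) (l : List (F × κ)) : List (F × ι) :=
  w ++ l.flatMap fun e => scaleList e.1 (v e.2)

theorem listSum_residue (v : κ → List (F × ι)) (w : List (F × ι)) (l : List (F × κ)) :
    listSum (residue v w l) = listSum w + (l.map fun e => e.1 • listSum (v e.2)).sum := by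
  rw [residue, listSum_append]
  congr 1
  induction l with
  | nil => simp [listSum]
  | cons e l ih => simp [listSum_append, listSum_scaleList, ih]

section Coefficients

variable [DecidableEq ι]

/-- The coefficient at `i` of a formal sum. -/
def coeffAt (l : List (F × ι)) (i : ι) : F :=
  l.foldl (fun s e => bif e.2 == i then s + e.1 else s) 0

theorem coeffAt_eq (l : List (F × ι)) (i : ι) : coeffAt l i = listSum l i := by
  have : ∀ (l : List (F × ι)) (s : F),
      l.foldl (fun s e => bif e.2 == i then s + e.1 else s) s = s + listSum l i := by
    intro l
    induction l with
    | nil => simp [listSum]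
    | cons e l ih =>
      intro s
      rw [List.foldl_cons, ih, listSum_cons]
      by_cases h : e.2 = i
      · simp [h, add_assoc]
      · simp [beq_false_of_ne h, h]
  simpa [coeffAt] using this l 0

/-- Whether all the coefficients of a formal sum outside `B` vanish. -/
def supportedIn [DecidableEq F] (B : ι → Bool) (l : List (F × ι)) : Bool :=
  l.all fun e => B e.2 || coeffAt l e.2 == 0

/-- Indices that do not occur in the list have coefficient zero, so a finite check suffices. With
`B` constantly false this is a test for zero. -/
theorem supportedIn_iff [DecidableEq F] (B : ι → Bool) (l : List (F × ι)) :
    supportedIn B l = true ↔ ∀ i, listSum l i ≠ 0 → B i = true := by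
  simp only [supportedIn, List.all_eq_true, Bool.or_eq_true, beq_iff_eq, coeffAt_eq]
  constructor
  · intro h i hi
    have : ∃ e ∈ l, e.2 = i := by
      by_contra! hne
      apply hi
      clear h hi
      induction l with
      | nil => simp [listSum]
      | cons e l ih =>
        rw [listSum_cons, Finsupp.add_apply, ih fun e he => hne e (List.mem_cons_of_mem _ he),
          Finsupp.single_eq_of_ne (hne e List.mem_cons_self).symm, add_zero]
    obtain ⟨e, he, rfl⟩ := this
    exact (h e he).resolve_right hi
  · intro h e _
    by_cases h0 : listSum l e.2 = 0
    · exact .inr h0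
    · exact .inl (h _ h0)

variable [Primcodable F] [Primcodable ι]

theorem computable_coeffAt (hF : IsComputableField F) :
    Computable₂ (coeffAt : List (F × ι) → ι → F) := by
  refine Computable.list_foldl
    (h := fun (p : List (F × ι) × ι) (q : F × F × ι) => bif q.2.2 == p.2 then q.1 + q.2.1 else q.1)
    .fst (.const 0) (.cond ?_ ?_ ?_)
  · exact Primrec.beq.to_comp.comp (Computable.snd.comp (.comp .snd .snd)) (.comp .snd .fst)
  · exact hF.add.comp (.comp .fst .snd) (.comp .fst (.comp .snd .snd))
  · exact .comp .fst .snd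

theorem computable_supportedIn [DecidableEq F] (hF : IsComputableField F) {B : ι → Bool} (hB : Computable B) :
    Computable (supportedIn (F := F) B) := by
  refine Computable.list_all (f := fun l : List (F × ι) => l)
    (q := fun l e => B e.2 || coeffAt l e.2 == 0) .id ?_
  refine Primrec.or.to_comp.comp (hB.comp (.comp .snd .snd)) (Primrec.beq.to_comp.comp ?_
    (.const 0))
  exact (computable_coeffAt hF).comp .fst (.comp .snd .snd)

end Coefficients

theorem computable_scaleList [Primcodable F] [Primcodable ι] (hF : IsComputableField F) :
    Computable₂ (scaleList : F → List (F × ι) → List (F × ι)) := by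
  refine Computable.list_map (f := fun q : F × List (F × ι) => q.2)
    (g := fun q e => (q.1 * e.1, e.2)) .snd ?_
  exact .pair (hF.mul.comp (.comp .fst .fst) (.comp .fst .snd)) (.comp .snd .snd)

theorem computable_residue [Primcodable F] [Primcodable ι] [Primcodable κ]
    (hF : IsComputableField F) {v : κ → List (F × ι)} (hv : Computable v) :
    Computable₂ (residue v) := by
  have h : Computable fun p : List (F × ι) × List (F × κ) =>
      p.2.flatMap fun e => scaleList e.1 (v e.2) := by
    refine Computable.list_flatMap (f := fun p : List (F × ι) × List (F × κ) => p.2)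
      (g := fun _ e => scaleList e.1 (v e.2)) .snd ?_
    exact (computable_scaleList hF).comp (.comp .fst .snd) (hv.comp (.comp .snd .snd))
  exact Computable.list_append.comp .fst h

theorem exists_residue_of_mem_span {v : κ → List (F × ι)} {g : ι →₀ F}
    (hg : g ∈ Submodule.span F (Set.range fun j => listSum (v j))) (w : List (F × ι)) :
    ∃ l, listSum (residue v w l) = listSum w + g := by
  obtain ⟨c, rfl⟩ := (Finsupp.mem_span_range_iff_exists_finsupp).1 hg
  refine ⟨c.support.toList.map fun j => (c j, j), ?_⟩
  rw [listSum_residue, List.map_map]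
  congr 1
  exact Finset.sum_map_toList c.support fun j => c j • listSum (v j)

/-- Membership in a subspace `J` is decidable for formal sums supported in `I₀` if `J` contains a
computable family `v` such that every basis vector with index in `I₀` reduces modulo `v` to a vector
supported in a decidable set `B` of indices, while `J` has no nonzero vector supported in `B`. -/
theorem computablePred_mem_of_reduction {α : Type*} [Primcodable α] [Primcodable F] [Primcodable ι]
    [Primcodable κ] (hF : IsComputableField F) (J : Submodule F (ι →₀ F)) (I₀ : Set ι)
    {B : ι → Bool} (hB : Computable B) {v : κ → List (F × ι)} (hv : Computable v)
    (hvJ : ∀ j, listSum (v j) ∈ J) (hJB : ∀ f ∈ J, (∀ i, f i ≠ 0 → B i = true) → f = 0)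
    (hred : ∀ i ∈ I₀, Finsupp.single i 1 ∈
      Submodule.span F (Set.range fun j => listSum (v j)) ⊔ Finsupp.supported F F {i | B i = true})
    {w : α → List (F × ι)} (hw : Computable w) (hwI : ∀ a, ∀ e ∈ w a, e.2 ∈ I₀) :
    ComputablePred fun a => listSum (w a) ∈ J := by
  classical
  have hspan : Submodule.span F (Set.range fun j => listSum (v j)) ≤ J :=
    Submodule.span_le.2 (by rintro _ ⟨j, rfl⟩; exact hvJ j)
  -- Termination of the search: if `w a` is `g + r` with `g` in the span and `r` supported in `B`, a
  -- combination representing `-g` leaves the residue `r`.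
  have hex : ∀ a, ∃ l : List (F × κ), supportedIn B (residue v (w a) l) = true := by
    intro a
    have hmem : listSum (w a) ∈ Submodule.span F (Set.range fun j => listSum (v j)) ⊔
        Finsupp.supported F F {i | B i = true} := by
      refine list_sum_mem fun x hx => ?_
      obtain ⟨e, he, rfl⟩ := List.mem_map.1 hx
      simpa using Submodule.smul_mem _ e.1 (hred _ (hwI a e he))
    obtain ⟨g, hg, r, hr, hgr⟩ := Submodule.mem_sup.1 hmem
    obtain ⟨l, hl⟩ := exists_residue_of_mem_span (neg_mem hg) (w a)
    refine ⟨l, (supportedIn_iff _ _).2 fun i hi => ?_⟩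
    rw [hl, ← hgr, add_comm g, add_neg_cancel_right] at hi
    exact hr (Finsupp.mem_support_iff.2 hi)
  -- Correctness, whichever combination is found: the residue differs from `w a` by an element of
  -- `J`, and being supported in `B` it lies in `J` only if it is zero.
  have hiff : ∀ a l, supportedIn B (residue v (w a) l) = true →
      (supportedIn (fun _ => false) (residue v (w a) l) = true ↔ listSum (w a) ∈ J) := by
    intro a l hl
    have hg : (l.map fun e => e.1 • listSum (v e.2)).sum ∈ J := by
      refine list_sum_mem fun x hx => ?_
      obtain ⟨e, -, rfl⟩ := List.mem_map.1 hx
      exact J.smul_mem _ (hvJ _)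
    rw [← J.add_mem_iff_left hg, ← listSum_residue]
    rw [supportedIn_iff] at hl ⊢
    constructor
    · intro h
      rw [show listSum (residue v (w a) l) = 0 from Finsupp.ext fun i => by
        by_contra h'; simpa using h i h']
      exact J.zero_mem
    · intro h i hi
      exact absurd (by rw [hJB _ h hl]; rfl) hi
  -- The number `m` codes a candidate combination; an answer is given only when its residue is
  -- supported in `B`.
  let test : α → ℕ → Option Bool := fun a m =>
    (Encodable.decode (α := List (F × κ)) m).bind fun l =>
      bif supportedIn B (residue v (w a) l) then
        some (supportedIn (fun _ => false) (residue v (w a) l)) else none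
  have htest : Computable₂ test := by
    refine Computable.option_bind (Computable.decode.comp .snd)
      (g := fun (p : α × ℕ) l => bif supportedIn B (residue v (w p.1) l) then
        some (supportedIn (fun _ => false) (residue v (w p.1) l)) else none) ?_
    have hres : Computable fun q : (α × ℕ) × List (F × κ) => residue v (w q.1.1) q.2 :=
      (computable_residue hF hv).comp (hw.comp (.comp .fst .fst)) .snd
    exact .cond ((computable_supportedIn hF hB).comp hres)
      (Computable.option_some.comp ((computable_supportedIn hF (.const false)).comp hres))
      (.const none)
  refine ⟨Classical.decPred _, (Partrec.rfindOpt htest).of_eq fun a => ?_⟩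
  have hdom : (Nat.rfindOpt (test a)).Dom := by
    obtain ⟨l, hl⟩ := hex a
    exact Nat.rfindOpt_dom.2 ⟨Encodable.encode l, _, by simp [test, hl]; rfl⟩
  refine Part.eq_some_iff.2 ?_
  obtain ⟨m, hm⟩ := Nat.rfindOpt_spec (Part.get_mem hdom)
  obtain ⟨l, -, hl⟩ := Option.bind_eq_some_iff.1 (Option.mem_def.1 hm)
  cases hs : supportedIn B (residue v (w a) l) with
  | false => simp [hs] at hl
  | true =>
    have h2 := hiff a l hs
    simp only [hs, cond_true, Option.some.injEq] at hl
    convert Part.get_mem hdom using 1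
    rw [← hl, Bool.eq_iff_iff, h2]
    simp

end FormalSums

/-! ### Signatures of words -/

section Signature

variable {n : ℕ} (p : Fin n ⊕ Fin n → ℕ)

/-- The products of `p` over the two contents of a word. -/
def FreeMagma.weight : FreeMagma (Fin n) → ℕ × ℕ
  | .of i => (p (.inl i), p (.inr i))
  | .mul s t => (s.weight.1 * t.weight.2, s.weight.1 * t.weight.2)

theorem FreeMagma.weight_eq (t : FreeMagma (Fin n)) :
    t.weight p = ((t.content.1.map p).prod, (t.content.2.map p).prod) := by
  induction t with
  | ih1 i => simp [FreeMagma.weight, FreeMagma.content]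
  | ih2 s t hs ht =>
    change FreeMagma.weight p (.mul s t) = (((FreeMagma.mul s t).content.1.map p).prod,
      ((FreeMagma.mul s t).content.2.map p).prod)
    simp [FreeMagma.weight, FreeMagma.content, hs, ht]

/-- The signature of a word: a generator is its own signature, and the signature of a product is
the weight by which it acts on products. -/
def FreeMagma.signature : FreeMagma (Fin n) → ℕ ⊕ Fin n
  | .of i => .inr i
  | .mul s t => .inl ((s.weight p).1 * (t.weight p).2)

/-- The effect on signatures of multiplication by a generator, on the left for the letter `inl i`
and on the right for the letter `inr i`. -/
def letterOp : Fin n ⊕ Fin n → ℕ ⊕ Fin n → ℕ ⊕ Fin n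
  | c, .inl m => .inl (p c * m)
  | .inl i, .inr j => .inl (p (.inl i) * p (.inr j))
  | .inr i, .inr j => .inl (p (.inl j) * p (.inr i))

theorem signature_of_mul (i : Fin n) (t : FreeMagma (Fin n)) :
    (FreeMagma.of i * t).signature p = letterOp p (.inl i) (t.signature p) := by
  cases t <;> rfl

theorem signature_mul_of (i : Fin n) (t : FreeMagma (Fin n)) :
    (t * FreeMagma.of i).signature p = letterOp p (.inr i) (t.signature p) := by
  cases t with
  | of j => rfl
  | mul s t => exact congrArg Sum.inl (mul_comm _ _)

/-- The iterated action of a list of letters on signatures. -/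
def listOp (l : List (Fin n ⊕ Fin n)) (i : ℕ ⊕ Fin n) : ℕ ⊕ Fin n :=
  l.foldr (letterOp p) i

theorem listOp_inl (l : List (Fin n ⊕ Fin n)) (m : ℕ) :
    listOp p l (.inl m) = .inl ((l.map p).prod * m) := by
  induction l with
  | nil => simp [listOp]
  | cons c l ih => rw [listOp, List.foldr_cons, ← listOp, ih]; simp [letterOp, mul_assoc]

variable {p}

theorem multiset_eq_of_prod_map_eq {X : Type*} {p : X → ℕ} (hp : ∀ c, (p c).Prime)
    (hinj : Function.Injective p) {m m' : Multiset X} (h : (m.map p).prod = (m'.map p).prod) :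
    m = m' := by
  refine Multiset.map_injective hinj ?_
  induction m using Quotient.inductionOn with | _ l => ?_
  induction m' using Quotient.inductionOn with | _ l' => ?_
  simp only [Multiset.quot_mk_to_coe, Multiset.map_coe, Multiset.prod_coe] at h ⊢
  exact Multiset.coe_eq_coe.2 ((Nat.primeFactorsList_unique h (by simp [hp])).trans
    (Nat.primeFactorsList_unique rfl (by simp [hp])).symm)

/-- Unique factorization recovers the content from the signature, so `lift_mul_congr` applies. -/
theorem lift_eq_of_signature_eq {A : Type*} [Mul A] [IsBicommutative A] (x : Fin n → A)
    (hp : ∀ c, (p c).Prime) (hinj : Function.Injective p) {s t : FreeMagma (Fin n)}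
    (h : s.signature p = t.signature p) : FreeMagma.lift x s = FreeMagma.lift x t := by
  cases s with
  | of i =>
    cases t with
    | of j => rw [Sum.inr.inj h]
    | mul t₁ t₂ => cases h
  | mul s₁ s₂ =>
    cases t with
    | of j => cases h
    | mul t₁ t₂ =>
      refine IsBicommutative.lift_mul_congr x (multiset_eq_of_prod_map_eq hp hinj ?_)
      simpa [FreeMagma.weight_eq] using Sum.inl.inj h

/-! ### Computability of signatures -/

/-- The course-of-values recursion step for weights: `l` is the list of the weights of the words
with smaller codes, `tbl` the list of the weights of the generators. -/
def weightStep (tbl l : List (ℕ × ℕ)) : Option (ℕ × ℕ) :=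
  -- `l.length` is the code of the current word. Codes below `tbl.length` are generators; otherwise
  -- the difference unpairs to the codes of the two factors, both smaller.
  tbl[l.length]? <|> (l[(l.length - tbl.length).unpair.1]?).bind fun u =>
    (l[(l.length - tbl.length).unpair.2]?).map fun v => (u.1 * v.2, u.1 * v.2)

theorem primrec_weightStep (tbl : List (ℕ × ℕ)) : Primrec (weightStep tbl) := by
  have hlen : Primrec fun l : List (ℕ × ℕ) => (l.length - tbl.length).unpair :=
    Primrec.unpair.comp (Primrec.nat_sub.comp .list_length (.const _))
  have h₁ : Primrec fun l : List (ℕ × ℕ) => l[(l.length - tbl.length).unpair.1]? :=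
    Primrec.list_getElem?.comp .id (Primrec.fst.comp hlen)
  have h₂ : Primrec fun l : List (ℕ × ℕ) => l[(l.length - tbl.length).unpair.2]? :=
    Primrec.list_getElem?.comp .id (Primrec.snd.comp hlen)
  have h₃ : Primrec₂ fun u v : ℕ × ℕ => (u.1 * v.2, u.1 * v.2) := by
    have : Primrec fun q : (ℕ × ℕ) × (ℕ × ℕ) => q.1.1 * q.2.2 :=
      Primrec.nat_mul.comp (.comp .fst .fst) (.comp .snd .snd)
    exact this.pair this
  have h₄ : Primrec₂ fun (l : List (ℕ × ℕ)) (u : ℕ × ℕ) =>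
      (l[(l.length - tbl.length).unpair.2]?).map fun v => (u.1 * v.2, u.1 * v.2) :=
    Primrec.option_map (h₂.comp .fst) (h₃.comp (.comp .snd .fst) .snd)
  have h₅ : Primrec fun l : List (ℕ × ℕ) => tbl[l.length]? :=
    Primrec.list_getElem?.comp (.const _) .list_length
  exact Primrec.option_orElse.comp h₅ (Primrec.option_bind h₁ h₄)

theorem weightStep_eq {n : ℕ} (p : Fin (n + 1) ⊕ Fin (n + 1) → ℕ) (m : ℕ) :
    weightStep (List.ofFn fun i => (p (.inl i), p (.inr i)))
      ((List.range m).map fun m => (termDecode n m).weight p) =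
        some ((termDecode n m).weight p) := by
  simp only [weightStep, List.length_map, List.length_range, List.getElem?_ofFn, List.length_ofFn]
  rw [termDecode]
  split_ifs with h
  · rfl
  · have h1 := Nat.unpair_left_le (m - (n + 1))
    have h2 := Nat.unpair_right_le (m - (n + 1))
    rw [List.getElem?_map, List.getElem?_map, List.getElem?_range (by omega),
      List.getElem?_range (by omega)]
    rfl

theorem primrec_weight {n : ℕ} (p : Fin (n + 1) ⊕ Fin (n + 1) → ℕ) :
    Primrec fun m => (termDecode n m).weight p :=
  (Primrec.nat_strong_rec (fun (_ : Unit) m => (termDecode n m).weight p)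
    ((primrec_weightStep _).comp₂ Primrec₂.right) fun _ => weightStep_eq p).comp (.const ()) .id

theorem primrec_signature {n : ℕ} (p : Fin (n + 1) ⊕ Fin (n + 1) → ℕ) :
    Primrec (FreeMagma.signature p) := by
  let tbl : List (ℕ ⊕ Fin (n + 1)) := List.ofFn fun i => .inr i
  -- For a product the signature is its first weight; the table takes precedence on the codes of
  -- generators.
  have h : Primrec fun m => (tbl[m]?).getD (Sum.inl ((termDecode n m).weight p).1) :=
    Primrec.option_getD.comp (Primrec.list_getElem?.comp (.const _) .id)
      (Primrec.sumInl.comp (Primrec.fst.comp (primrec_weight p)))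
  have he : @Primrec _ _ (termPrimcodable (n + 1)) _ (termEquiv n) :=
    Primrec.of_equiv (e := termEquiv n)
  refine (h.comp he).of_eq fun t => ?_
  rw [show termDecode n (termEquiv n t) = t from termDecode_termCode t]
  cases t with
  | of i =>
    simp only [tbl, List.getElem?_ofFn]
    rw [dif_pos (show (termEquiv n (.of i)) < n + 1 from i.2)]
    rfl
  | mul s t =>
    rw [List.getElem?_eq_none (by
      simp only [tbl, List.length_ofFn, termEquiv, Equiv.coe_fn_mk, termCode]; omega)]
    rfl

theorem primrec_listOp : Primrec₂ (listOp p) := by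
  have h : Primrec₂ (letterOp p) := by
    let f : (Fin n ⊕ Fin n) × Fin n → ℕ
      | (.inl i, j) => p (.inl i) * p (.inr j)
      | (.inr i, j) => p (.inl j) * p (.inr i)
    refine (Primrec.sumCasesOn (f := fun q : (Fin n ⊕ Fin n) × (ℕ ⊕ Fin n) => q.2)
      (g := fun q m => .inl (p q.1 * m)) (h := fun q j => .inl (f (q.1, j))) .snd ?_ ?_).of_eq ?_
    · exact Primrec.sumInl.comp (Primrec.nat_mul.comp
        ((Primrec.dom_finite p).comp (.comp .fst .fst)) .snd)
    · exact Primrec.sumInl.comp ((Primrec.dom_finite f).comp (.pair (.comp .fst .fst) .snd))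
    · rintro ⟨i | i, m | j⟩ <;> rfl
  exact Primrec.list_foldr (h := fun _ q => letterOp p q.1 q.2) .fst .snd
    (h.comp (.comp .fst .snd) (.comp .snd .snd))

end Signature

/-! ### Leading signatures -/

section Smooth

variable {X : Type*} (p : X → ℕ)

/-- The nonzero natural numbers all of whose prime factors are values of `p`. -/
def IsSmooth (m : ℕ) : Prop := m ≠ 0 ∧ ∀ q : ℕ, q.Prime → q ∣ m → q ∈ Set.range p

variable {p}

theorem IsSmooth.mul {m m' : ℕ} (h : IsSmooth p m) (h' : IsSmooth p m') :
    IsSmooth p (m * m') :=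
  ⟨mul_ne_zero h.1 h'.1, fun q hq hd => (hq.dvd_mul.1 hd).elim (h.2 q hq) (h'.2 q hq)⟩

theorem IsSmooth.of_dvd {m d : ℕ} (h : IsSmooth p m) (hd : d ∣ m) : IsSmooth p d :=
  ⟨ne_zero_of_dvd_ne_zero h.1 hd, fun q hq hqd => h.2 q hq (hqd.trans hd)⟩

theorem isSmooth_apply (hp : ∀ c, (p c).Prime) (c : X) : IsSmooth p (p c) :=
  ⟨(hp c).ne_zero, fun _ hq hd => ⟨c, ((Nat.prime_dvd_prime_iff_eq hq (hp c)).1 hd).symm⟩⟩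

theorem IsSmooth.exists_list {m : ℕ} (h : IsSmooth p m) : ∃ l : List X, (l.map p).prod = m := by
  have : m.primeFactorsList ∈ Set.range (List.map p) := by
    rw [Set.range_list_map]
    exact fun q hq => h.2 q (Nat.prime_of_mem_primeFactorsList hq)
      (Nat.dvd_of_mem_primeFactorsList hq)
  obtain ⟨l, hl⟩ := this
  exact ⟨l, by rw [hl, Nat.prod_primeFactorsList h.1]⟩

/-- Dickson's lemma for smooth numbers. -/
theorem exists_finite_dvd_basis [Finite X] {s : Set ℕ} (hs : ∀ m ∈ s, IsSmooth p m) :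
    ∃ D ⊆ s, D.Finite ∧ ∀ m ∈ s, ∃ d ∈ D, d ∣ m := by
  -- Exponent vectors at the primes `p c`. For smooth `d` no other prime matters, so comparing these
  -- vectors gives divisibility.
  let e : ℕ → X → ℕ := fun m c => m.factorization (p c)
  have hdvd : ∀ d m, IsSmooth p d → m ≠ 0 → e d ≤ e m → d ∣ m := by
    intro d m hd hm h
    refine (Nat.factorization_le_iff_dvd hd.1 hm).1 fun q => ?_
    by_cases hq : q.Prime ∧ q ∣ d
    · obtain ⟨c, rfl⟩ := hd.2 q hq.1 hq.2
      exact h c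
    · rw [Nat.factorization_eq_zero_iff _ _ |>.2 (by tauto)]
      exact Nat.zero_le _
  -- Minimal vectors form an antichain in `X → ℕ`, which is well-quasi-ordered because `X` is
  -- finite.
  have hfin : {a | Minimal (· ∈ e '' s) a}.Finite :=
    WellQuasiOrderedLE.finite_of_isAntichain (setOfPred_minimal_antichain _)
  have hpre : ∀ a ∈ {a | Minimal (· ∈ e '' s) a}, ∃ m ∈ s, e m = a := fun a ha => ha.1
  choose! g hgs hge using hpre
  refine ⟨g '' {a | Minimal (· ∈ e '' s) a}, ?_, hfin.image g, fun m hm => ?_⟩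
  · rintro _ ⟨a, ha, rfl⟩
    exact hgs a ha
  · obtain ⟨a, ham, ha⟩ := exists_minimal_le_of_wellFoundedLT (· ∈ e '' s) (e m) ⟨m, hm, rfl⟩
    exact ⟨g a, ⟨a, ha, rfl⟩, hdvd _ _ (hs _ (hgs a ha)) (hs m hm).1 ((hge a ha).trans_le ham)⟩

end Smooth

/-! ### Gröbner reduction for subspaces stable under the letters -/

section Leading

variable {n : ℕ} {F : Type*} [Field F]

/-- The key that orders signatures: signatures of products by size, then the generators. -/
def sigKey : ℕ ⊕ Fin n → ℕ ×ₗ ℕ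
  | .inl m => toLex (0, m)
  | .inr j => toLex (1, j)

theorem sigKey_injective : Function.Injective (sigKey (n := n)) := by
  rintro (a | a) (b | b) h <;> simp_all [sigKey, Fin.ext_iff]

/-- This is why generators are placed on top: a vector led by a product signature involves only
product signatures, on which the letters act by multiplication and preserve the order. -/
theorem lt_sigKey_inl {j : ℕ ⊕ Fin n} {m : ℕ} (h : sigKey j < sigKey (n := n) (.inl m)) :
    ∃ a < m, j = .inl a := by
  rcases j with a | a
  · exact ⟨a, by simpa [sigKey, Prod.Lex.toLex_lt_toLex] using h, rfl⟩
  · simp [sigKey, Prod.Lex.toLex_lt_toLex] at h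

/-- The leading indices of the elements of a subspace. -/
def IsLead (J : Submodule F (ℕ ⊕ Fin n →₀ F)) (i : ℕ ⊕ Fin n) : Prop :=
  ∃ g ∈ J, g i = 1 ∧ ∀ j, g j ≠ 0 → sigKey j ≤ sigKey i

theorem exists_isLead {J : Submodule F (ℕ ⊕ Fin n →₀ F)} {f : ℕ ⊕ Fin n →₀ F} (hf : f ∈ J)
    (h0 : f ≠ 0) : ∃ i, f i ≠ 0 ∧ IsLead J i := by
  obtain ⟨i, hi, hmax⟩ := f.support.exists_max_image sigKey (Finsupp.support_nonempty_iff.2 h0)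
  have hi' := Finsupp.mem_support_iff.1 hi
  refine ⟨i, hi', (f i)⁻¹ • f, J.smul_mem _ hf, by simp [hi'], fun j hj => hmax j ?_⟩
  rw [Finsupp.mem_support_iff]
  rintro h
  simp [h] at hj

/-- Signatures whose weight is smooth. -/
def smoothSigs (p : Fin n ⊕ Fin n → ℕ) : Set (ℕ ⊕ Fin n) :=
  {i | ∀ m, i = .inl m → IsSmooth p m}

variable {p : Fin n ⊕ Fin n → ℕ}

theorem letterOp_mem_smoothSigs (hp : ∀ c, (p c).Prime) (c : Fin n ⊕ Fin n) {i : ℕ ⊕ Fin n}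
    (hi : i ∈ smoothSigs p) : letterOp p c i ∈ smoothSigs p := by
  rcases i with m | j
  · rintro _ ⟨⟩
    exact (isSmooth_apply hp c).mul (hi m rfl)
  · rcases c with c | c <;> rintro _ ⟨⟩ <;> exact (isSmooth_apply hp _).mul (isSmooth_apply hp _)

theorem listOp_mem_smoothSigs (hp : ∀ c, (p c).Prime) (l : List (Fin n ⊕ Fin n)) {i : ℕ ⊕ Fin n}
    (hi : i ∈ smoothSigs p) : listOp p l i ∈ smoothSigs p := by
  induction l with
  | nil => exact hi
  | cons c l ih => exact letterOp_mem_smoothSigs hp c ih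

theorem mapDomain_listOp_mem {J : Submodule F (ℕ ⊕ Fin n →₀ F)}
    (hJ : ∀ c, ∀ f ∈ J, Finsupp.mapDomain (letterOp p c) f ∈ J) (l : List (Fin n ⊕ Fin n))
    {f : ℕ ⊕ Fin n →₀ F} (hf : f ∈ J) : Finsupp.mapDomain (listOp p l) f ∈ J := by
  induction l with
  | nil =>
    change Finsupp.mapDomain id f ∈ J
    rwa [Finsupp.mapDomain_id]
  | cons c l ih =>
    change Finsupp.mapDomain (letterOp p c ∘ listOp p l) f ∈ J
    rw [Finsupp.mapDomain_comp]
    exact hJ c _ ih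

/-- One reduction step: the leading term is the whole vector minus the other terms. Terms are
indexed by the source, so `φ` need not be injective. -/
theorem single_mem_of_mapDomain_mem {ι κ : Type*} {U : Submodule F (κ →₀ F)} {g : ι →₀ F}
    {φ : ι → κ} {d : ι} (hd : g d = 1) (h : Finsupp.mapDomain φ g ∈ U)
    (hU : ∀ j, j ≠ d → g j ≠ 0 → Finsupp.single (φ j) (1 : F) ∈ U) :
    Finsupp.single (φ d) (1 : F) ∈ U := by
  classical
  have hmem : d ∈ g.support := by simp [hd]
  rw [Finsupp.mapDomain, Finsupp.sum, ← Finset.add_sum_erase _ _ hmem, hd] at h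
  refine (U.add_mem_iff_left (U.sum_mem fun j hj => ?_)).1 h
  obtain ⟨hne, hj⟩ := Finset.mem_erase.1 hj
  simpa using U.smul_mem (g j) (hU j hne (Finsupp.mem_support_iff.1 hj))

/-- Membership is decidable for a subspace spanned by vectors with smooth signatures and closed
under the letter operations. -/
theorem computablePred_mem_of_letterOp_closed [Primcodable F] (hF : IsComputableField F)
    (hp : ∀ c, (p c).Prime) (J : Submodule F (ℕ ⊕ Fin n →₀ F))
    (hJs : J ≤ Finsupp.supported F F (smoothSigs p))
    (hJ : ∀ c, ∀ f ∈ J, Finsupp.mapDomain (letterOp p c) f ∈ J) {α : Type*} [Primcodable α]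
    {w : α → List (F × (ℕ ⊕ Fin n))} (hw : Computable w)
    (hwI : ∀ a, ∀ e ∈ w a, e.2 ∈ smoothSigs p) :
    ComputablePred fun a => listSum (w a) ∈ J := by
  classical
  have hsupp : ∀ f ∈ J, ∀ i, f i ≠ 0 → i ∈ smoothSigs p := fun f hf i hi =>
    hJs hf (Finsupp.mem_support_iff.2 hi)
  have hlead : ∀ i, IsLead J i → i ∈ smoothSigs p := by
    rintro i ⟨g, hg, hgi, -⟩
    exact hsupp g hg i (by simp [hgi])
  obtain ⟨D, hDs, hDfin, hD⟩ := exists_finite_dvd_basis (s := {m | IsLead J (.inl m)})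
    fun m hm => hlead _ hm m rfl
  have hfin : (Sum.inl '' D ∪ Sum.inr '' {j | IsLead J (.inr j)} : Set (ℕ ⊕ Fin n)).Finite :=
    (hDfin.image _).union ((Set.toFinite _).image _)
  -- The basis is chosen nonconstructively; `G` is nevertheless computable, being a function on the
  -- finite type `Fin r`.
  obtain ⟨r, d, -, hd⟩ := hfin.fin_param
  have hdlead : ∀ k, IsLead J (d k) := by
    intro k
    rcases hd ▸ Set.mem_range_self k with ⟨m, hm, h⟩ | ⟨j, hj, h⟩
    · exact h ▸ hDs hm
    · exact h ▸ hj
  choose g hgJ hgd hgle using hdlead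
  choose G hG _ using fun k => exists_listSum_eq (g k)
  let v : Fin r × List (Fin n ⊕ Fin n) → List (F × (ℕ ⊕ Fin n)) := fun q =>
    (G q.1).map fun e => (e.1, listOp p q.2 e.2)
  have hv : Computable v := by
    refine Computable.list_map ((Primrec.dom_finite G).to_comp.comp .fst)
      (g := fun q e => (e.1, listOp p q.2 e.2)) ?_
    exact .pair (.comp .fst .snd) (primrec_listOp.to_comp.comp (.comp .snd .fst) (.comp .snd .snd))
  have hvsum : ∀ k l, listSum (v (k, l)) = Finsupp.mapDomain (listOp p l) (g k) := fun k l => by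
    rw [listSum_map, hG]
  -- Indices allowed in normal forms: numbers with no divisor in `D`, and generators that are not
  -- leading.
  let B : ℕ ⊕ Fin n → Bool := fun i => Sum.casesOn i
    (fun m => hDfin.toFinset.toList.all fun d => !(m % d == 0))
    (fun j => !(decide (IsLead J (.inr j))))
  have hBinl : ∀ m, B (.inl m) = true ↔ ∀ d ∈ D, ¬ d ∣ m := by
    intro m
    simp [B, Nat.dvd_iff_mod_eq_zero]
  have hB : Computable B := by
    refine Computable.sumCasesOn .id (g := fun _ m =>
      hDfin.toFinset.toList.all fun d => !(m % d == 0))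
      (h := fun _ j => !(decide (IsLead J (.inr j)))) ?_ ?_
    · refine Computable.list_all (f := fun _ => hDfin.toFinset.toList)
        (q := fun (q : (ℕ ⊕ Fin n) × ℕ) d => !(q.2 % d == 0)) (.const _) ?_
      exact Primrec.not.to_comp.comp (Primrec.beq.to_comp.comp
        (Primrec.nat_mod.to_comp.comp (.comp .snd .fst) .snd) (.const 0))
    · exact (Primrec.dom_finite fun j => !(decide (IsLead J (.inr j)))).to_comp.comp .snd
  refine computablePred_mem_of_reduction hF J (smoothSigs p) hB hv ?_ ?_ ?_ hw hwI
  · rintro ⟨k, l⟩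
    rw [hvsum]
    exact mapDomain_listOp_mem hJ l (hgJ k)
  · intro f hf hfB
    by_contra h0
    obtain ⟨i, hi, hil⟩ := exists_isLead hf h0
    have hBi := hfB i hi
    rcases i with m | j
    · obtain ⟨d, hdD, hdm⟩ := hD m hil
      exact (hBinl m).1 hBi d hdD hdm
    · simp [B, hil] at hBi
  · set U := Submodule.span F (Set.range fun j => listSum (v j)) ⊔
      Finsupp.supported F F {i | B i = true} with hU
    have hvU : ∀ k l, Finsupp.mapDomain (listOp p l) (g k) ∈ U := fun k l =>
      Submodule.mem_sup_left (Submodule.subset_span ⟨(k, l), hvsum k l⟩)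
    -- a vector of the family reduces its leading index to smaller ones
    have hstep : ∀ k l, (∀ j, sigKey j < sigKey (d k) → j ∈ smoothSigs p →
        Finsupp.single (listOp p l j) (1 : F) ∈ U) →
          Finsupp.single (listOp p l (d k)) (1 : F) ∈ U := by
      intro k l h
      refine single_mem_of_mapDomain_mem (hgd k) (hvU k l) fun j hne hj => ?_
      exact h j (lt_of_le_of_ne (hgle k j hj) fun he => hne (sigKey_injective he))
        (hsupp _ (hgJ k) j hj)
    intro i
    -- Each reducible index is replaced by smaller smooth ones, so reduction ends by induction along
    -- `sigKey`.
    refine (InvImage.wf (sigKey (n := n)) wellFounded_lt).induction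
      (C := fun i => i ∈ smoothSigs p → Finsupp.single i (1 : F) ∈ U) i fun i ih hi => ?_
    rcases em (B i = true) with hBi | hBi
    · exact Submodule.mem_sup_right (Finsupp.single_mem_supported F _ hBi)
    rcases i with m | j
    · rw [hBinl] at hBi
      push Not at hBi
      obtain ⟨a, ha, b, rfl⟩ := hBi
      obtain ⟨k, hk⟩ : Sum.inl a ∈ Set.range d := hd ▸ .inl ⟨a, ha, rfl⟩
      -- Smoothness makes the cofactor `b` a product of letter primes, so a translate of the basis
      -- vector led by `a` is led by `a * b`.
      obtain ⟨l, rfl⟩ := ((hi _ rfl).of_dvd (Dvd.intro_left _ rfl)).exists_list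
      have h := hstep k l fun j hj hjs => ?_
      · rwa [hk, listOp_inl, mul_comm] at h
      rw [hk] at hj
      refine ih _ ?_ (listOp_mem_smoothSigs hp l hjs)
      obtain ⟨b, hb, rfl⟩ := lt_sigKey_inl hj
      have hpos : 0 < (l.map p).prod := List.prod_pos fun a ha => by
        obtain ⟨c, -, rfl⟩ := List.mem_map.1 ha
        exact (hp c).pos
      change sigKey _ < sigKey _
      simpa [listOp_inl, sigKey, Prod.Lex.toLex_lt_toLex, mul_comm a] using
        Nat.mul_lt_mul_of_pos_left hb hpos
    · have hj : IsLead J (.inr j) := by simpa [B] using hBi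
      obtain ⟨k, hk⟩ : Sum.inr j ∈ Set.range d := hd ▸ .inr ⟨j, hj, rfl⟩
      -- A leading generator is reduced by its basis vector untranslated: multiplication by a letter
      -- would take it out of the generators.
      have h := hstep k [] fun j hj hjs => ?_
      · rwa [hk] at h
      rw [hk] at hj
      exact ih j hj hjs

end Leading

/-! ### The word problem -/

section WordProblem

variable {F : Type*} [Field F] {A : Type*} [NonUnitalNonAssocRing A] [Module F A]
  [IsScalarTower F A A] [SMulCommClass F A A] {n : ℕ} (x : Fin n → A)
  (p : Fin n ⊕ Fin n → ℕ)

/-- The relations between the values of words at `x`, transported to signatures. -/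
noncomputable def relationSpace : Submodule F (ℕ ⊕ Fin n →₀ F) :=
  (LinearMap.ker (Finsupp.linearCombination F (FreeMagma.lift x : FreeMagma (Fin n) → A))).map
    (Finsupp.lmapDomain F F (FreeMagma.signature p))

variable {p}

-- Evaluation factors through the signature, so passing to signatures creates no new relations.
-- `Function.extend` takes the irrelevant value `0` at indices that are not signatures.
omit [IsScalarTower F A A] [SMulCommClass F A A] in
theorem mapDomain_signature_mem_iff [IsBicommutative A] (hp : ∀ c, (p c).Prime)
    (hinj : Function.Injective p) (w : FreeMagma (Fin n) →₀ F) :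
    Finsupp.mapDomain (FreeMagma.signature p) w ∈ relationSpace (F := F) x p ↔
      Finsupp.linearCombination F (FreeMagma.lift x : FreeMagma (Fin n) → A) w = 0 := by
  have hfac : Function.FactorsThrough (FreeMagma.lift x : FreeMagma (Fin n) → A)
      (FreeMagma.signature p) := fun s t h => lift_eq_of_signature_eq x hp hinj h
  have key : ∀ w, Finsupp.linearCombination F (FreeMagma.lift x : FreeMagma (Fin n) → A) w =
      Finsupp.linearCombination F (Function.extend (FreeMagma.signature p) (FreeMagma.lift x) 0)
        (Finsupp.mapDomain (FreeMagma.signature p) w) := by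
    intro w
    rw [Finsupp.linearCombination_mapDomain]
    congr 2
    exact funext fun t => (hfac.extend_apply 0 t).symm
  constructor
  · rintro ⟨w', hw', h⟩
    rw [key, ← h]
    exact (key w').symm.trans hw'
  · exact fun h => ⟨w, h, rfl⟩

/-- Multiplying a relation by a generator gives a relation, and on signatures this multiplication is
`letterOp`. -/
theorem mapDomain_letterOp_mem (c : Fin n ⊕ Fin n) {f : ℕ ⊕ Fin n →₀ F}
    (hf : f ∈ relationSpace (F := F) x p) :
    Finsupp.mapDomain (letterOp p c) f ∈ relationSpace (F := F) x p := by
  obtain ⟨w, hw, rfl⟩ := hf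
  have hw : Finsupp.linearCombination F (FreeMagma.lift x : FreeMagma (Fin n) → A) w = 0 := hw
  rw [Finsupp.linearCombination_apply, Finsupp.sum] at hw
  rw [Finsupp.lmapDomain_apply, ← Finsupp.mapDomain_comp]
  rcases c with i | i
  · refine ⟨Finsupp.mapDomain (FreeMagma.of i * ·) w, ?_, ?_⟩
    · change Finsupp.linearCombination F _ _ = 0
      rw [Finsupp.linearCombination_mapDomain, Finsupp.linearCombination_apply, Finsupp.sum]
      simp only [Function.comp_apply, map_mul, ← mul_smul_comm, ← Finset.mul_sum, hw, mul_zero]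
    · rw [Finsupp.lmapDomain_apply, ← Finsupp.mapDomain_comp]
      congr 1
      exact funext fun t => signature_of_mul p i t
  · refine ⟨Finsupp.mapDomain (· * FreeMagma.of i) w, ?_, ?_⟩
    · change Finsupp.linearCombination F _ _ = 0
      rw [Finsupp.linearCombination_mapDomain, Finsupp.linearCombination_apply, Finsupp.sum]
      simp only [Function.comp_apply, map_mul, ← smul_mul_assoc, ← Finset.sum_mul, hw, zero_mul]
    · rw [Finsupp.lmapDomain_apply, ← Finsupp.mapDomain_comp]
      congr 1
      exact funext fun t => signature_mul_of p i t

theorem isSmooth_weight (hp : ∀ c, (p c).Prime) (t : FreeMagma (Fin n)) :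
    IsSmooth p (t.weight p).1 ∧ IsSmooth p (t.weight p).2 := by
  induction t with
  | ih1 i => exact ⟨isSmooth_apply hp _, isSmooth_apply hp _⟩
  | ih2 s t hs ht => exact ⟨hs.1.mul ht.2, hs.1.mul ht.2⟩

theorem signature_mem_smoothSigs (hp : ∀ c, (p c).Prime) (t : FreeMagma (Fin n)) :
    t.signature p ∈ smoothSigs p := by
  cases t with
  | of i => rintro _ ⟨⟩
  | mul s t =>
    rintro _ ⟨⟩
    exact (isSmooth_weight hp s).1.mul (isSmooth_weight hp t).2

omit [IsScalarTower F A A] [SMulCommClass F A A] in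
theorem relationSpace_le_supported (hp : ∀ c, (p c).Prime) :
    relationSpace (F := F) x p ≤ Finsupp.supported F F (smoothSigs p) := by
  rintro _ ⟨w, -, rfl⟩
  rw [Finsupp.lmapDomain_apply, Finsupp.mapDomain, Finsupp.sum]
  exact Submodule.sum_mem _ fun t _ =>
    Finsupp.single_mem_supported F _ (signature_mem_smoothSigs hp t)

theorem exists_injective_primes (n : ℕ) :
    ∃ p : Fin n ⊕ Fin n → ℕ, (∀ c, (p c).Prime) ∧ Function.Injective p := by
  refine ⟨fun c => Nat.nth Nat.Prime (finSumFinEquiv c), fun c => Nat.prime_nth_prime _, ?_⟩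
  exact (Nat.nth_injective Nat.infinite_setOfPred_prime).comp
    (Fin.val_injective.comp finSumFinEquiv.injective)

/-- Equality of the values of formal linear combinations of words is decidable at any finite family
of elements of any bicommutative algebra over a computable field. -/
theorem computablePred_eval_eq [IsBicommutative A] [Primcodable F] (hF : IsComputableField F)
    {n : ℕ} (x : Fin n → A) :
    ComputablePred fun q : LinWord F n × LinWord F n =>
      Finsupp.linearCombination F (FreeMagma.lift x : FreeMagma (Fin n) → A) (listSum q.1) =
        Finsupp.linearCombination F (FreeMagma.lift x) (listSum q.2) := by
  classical
  cases n with
  | zero =>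
    have hnil : ∀ w : LinWord F 0, w = [] := fun w =>
      List.eq_nil_iff_forall_not_mem.2 fun e _ => term_isEmpty e.2
    refine ⟨inferInstance, (Computable.const true).of_eq fun q => ?_⟩
    simp [hnil q.1, hnil q.2]
  | succ n =>
    obtain ⟨p, hp, hinj⟩ := exists_injective_primes (n + 1)
    -- The difference of the two combinations, transported to signatures.
    let w : LinWord F (n + 1) × LinWord F (n + 1) → List (F × (ℕ ⊕ Fin (n + 1))) := fun q =>
      (q.1.map fun e => (e.1, e.2.signature p)) ++ (q.2.map fun e => (-e.1, e.2.signature p))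
    have hsig : Computable (FreeMagma.signature p) := (primrec_signature p).to_comp
    have hw : Computable w := by
      refine Computable.list_append.comp
        (Computable.list_map (f := fun q : LinWord F (n + 1) × LinWord F (n + 1) => q.1)
          (g := fun _ e => (e.1, e.2.signature p)) .fst ?_)
        (Computable.list_map (f := fun q : LinWord F (n + 1) × LinWord F (n + 1) => q.2)
          (g := fun _ e => (-e.1, e.2.signature p)) .snd ?_)
      · exact .pair (.comp .fst .snd) (hsig.comp (.comp .snd .snd))
      · exact .pair (hF.neg.comp (.comp .fst .snd)) (hsig.comp (.comp .snd .snd))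
    have hneg : ∀ l : LinWord F (n + 1), listSum (l.map fun e => (-e.1, e.2.signature p)) =
        -Finsupp.mapDomain (FreeMagma.signature p) (listSum l) := by
      intro l
      rw [← listSum_map, ← neg_one_smul F, ← listSum_scaleList, scaleList, List.map_map]
      simp [Function.comp_def]
    refine ComputablePred.of_eq (computablePred_mem_of_letterOp_closed hF hp
      (relationSpace (F := F) x p) (relationSpace_le_supported x hp)
      (fun c f hf => mapDomain_letterOp_mem x c hf) hw ?_) fun q => ?_
    · intro q e he
      rcases List.mem_append.1 he with h | h <;> obtain ⟨e', -, rfl⟩ := List.mem_map.1 h <;>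
        exact signature_mem_smoothSigs hp _
    · rw [listSum_append, listSum_map, hneg, ← sub_eq_add_neg, ← Finsupp.mapDomain_sub,
        mapDomain_signature_mem_iff x hp hinj, map_sub, sub_eq_zero]

theorem LinWord.eval_eq_linearCombination {k : Type*} [Field k] [Algebra F k] {B : Type*}
    [NonUnitalNonAssocRing B] [Module k B] [Module F B] [IsScalarTower F k B] (y : Fin n → B)
    (w : LinWord F n) :
    w.eval k y = Finsupp.linearCombination F (FreeMagma.lift y) (listSum w) := by
  rw [LinWord.eval, listSum, map_list_sum, List.map_map]
  congr 2
  funext e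
  simp [algebraMap_smul]

end WordProblem

/-! Finitely generated bicommutative algebras are noetherian, and the argument applies to an arbitrary
ideal of relations: the finiteness of `S` is not needed. -/

/-- Over an arbitrary field `k`, every finitely presented bicommutative algebra has a solvable
word problem, for words with coefficients in any computable subfield `F` of `k` (in particular in
`k` itself when `k` is computable, and in the prime field for arbitrary `k`). -/
theorem mainTheorem6 (F : Type*) [Field F] [Primcodable F] (hF : IsComputableField F)
    (k : Type*) [Field k] [Algebra F k] (n : ℕ)
    (S : Set (FreeBicomm k (Fin n))) (hS : S.Finite) :
    WordProblemSolvable F S := by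
  -- Restriction of scalars: only the `F`-linear relations between values of words matter, so `k`
  -- itself need not be computable.
  let _ : Module F (PresentedBicomm S) := Module.compHom _ (algebraMap F k)
  have : IsScalarTower F k (PresentedBicomm S) := .of_algebraMap_smul fun _ _ => rfl
  have : IsScalarTower F (PresentedBicomm S) (PresentedBicomm S) :=
    ⟨fun a u v => smul_mul_assoc (algebraMap F k a) u v⟩
  have : SMulCommClass F (PresentedBicomm S) (PresentedBicomm S) :=
    ⟨fun a u v => (mul_smul_comm (algebraMap F k a) u v).symm⟩
  refine (computablePred_eval_eq hF (PresentedBicomm.of S)).of_eq fun q => ?_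
  rw [LinWord.eval_eq_linearCombination, LinWord.eval_eq_linearCombination]
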